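/- There is a universal constant $C>0$ such that for all integers $n\ge 2$ and $k\ge 2$, every matrix $W\in\mathbb{R}^{n\times k}$ and every $\theta\in\mathbb{R}^k$, the (possibly unbounded) polytope with $k$ faces $\mathcal{K}=\{x\in\mathbb{R}^n : W^Tx\le\theta\}$ (coordinatewise inequality) satisfies $$\left|\Pr_{X}\left[X\in\mathcal{K}\right]-\Pr_{Y}\left[Y/\sqrt{n}\in\mathcal{K}\right]\right|\le\frac{C\,\log n\,\log k}{\sqrt{n}},$$ where $X$ is uniformly distributed on the unit sphere $S^{n-1}\subset\mathbb{R}^n$ and $Y$ is a standard Gaussian vector in $\mathbb{R}^n$ (mean $0$, identity covariance). -/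

import Mathlib

/-- The polytope `{x ∈ ℝⁿ : Wᵀ x ≤ θ}` (coordinatewise inequality) with `k` faces: the
intersection of the `k` halfspaces whose normals are the columns of `W`. -/
def polytope {n k : ℕ} (W : Matrix (Fin n) (Fin k) ℝ) (θ : Fin k → ℝ) :
    Set (EuclideanSpace ℝ (Fin n)) :=
  {x | W.transpose.mulVec x.ofLp ≤ θ}

/-- The uniform distribution on the unit sphere of `ℝⁿ`: the surface measure induced by
Lebesgue measure, normalized to total mass one. -/
noncomputable def sphereUniform (n : ℕ) :
    MeasureTheory.Measure (Metric.sphere (0 : EuclideanSpace ℝ (Fin n)) 1) :=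
  ((MeasureTheory.volume : MeasureTheory.Measure (EuclideanSpace ℝ (Fin n))).toSphere
      Set.univ)⁻¹ •
    (MeasureTheory.volume : MeasureTheory.Measure (EuclideanSpace ℝ (Fin n))).toSphere

/-! The direction of a standard Gaussian vector `Y` in `ℝⁿ` is uniform on the sphere, and `‖Y‖` is
within a factor `1 ± ε` of `√n` outside an event of probability at most `2 exp (-n ε² / 16)`; take
`ε` of order `√(log n / n)`. On the good event, membership of `Y / ‖Y‖` in the polytope lies between
membership of `Y` in the two polytopes whose thresholds are `√n θ ± ε |√n θ|`, so it remains to see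
that perturbing each threshold `t` by `ε |t|` changes the Gaussian measure by `O(ε log k)`.

Split the resulting boundary layer according to which facet is violated most. Moving along the
outer normal `w` of its facet never leaves a cell of this partition, and the layer meets the cell
inside the slab `t < ⟪w, x⟫ ≤ t + ε |t|`. Translating by multiples of the width of the slab shows
that, for `‖w‖ = 1` and `t² ≲ log k`, the slab carries only an `O(ε log k)` fraction of the mass
of the cell, and these masses sum to at most one. Facets with `t² ≫ log k` contribute
`O(ε / k)` each by the Gaussian tail.
-/

open MeasureTheory ProbabilityTheory Real
open scoped RealInnerProductSpace ENNReal

section Density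

variable {E : Type*} [NormedAddCommGroup E] [InnerProductSpace ℝ E]

/-- The density `(2π)^(-d/2) exp(-‖x‖²/2)` of the standard Gaussian measure on a
`d`-dimensional Euclidean space, with respect to Lebesgue measure. -/
noncomputable def stdGaussianPDFReal (x : E) : ℝ :=
  (2 * π) ^ (-(Module.finrank ℝ E / 2 : ℝ)) * rexp (-‖x‖ ^ 2 / 2)

lemma stdGaussianPDFReal_nonneg (x : E) : 0 ≤ stdGaussianPDFReal x := by
  unfold stdGaussianPDFReal
  positivity

variable [MeasurableSpace E] [BorelSpace E]

@[fun_prop]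
lemma measurable_stdGaussianPDFReal : Measurable (stdGaussianPDFReal : E → ℝ) := by
  unfold stdGaussianPDFReal
  fun_prop

variable [FiniteDimensional ℝ E]

lemma integral_stdGaussianPDFReal_mul_exp {t : ℝ} (ht : t < 1 / 2) :
    ∫ x : E, stdGaussianPDFReal x * rexp (t * ‖x‖ ^ 2) =
      (1 - 2 * t) ^ (-(Module.finrank ℝ E / 2 : ℝ)) := by
  have hb : 0 < 1 / 2 - t := by linarith
  have h1 : 0 < 1 - 2 * t := by linarith
  have hexp : ∀ x : E, stdGaussianPDFReal x * rexp (t * ‖x‖ ^ 2) =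
      (2 * π) ^ (-(Module.finrank ℝ E / 2 : ℝ)) * rexp (-(1 / 2 - t) * ‖x‖ ^ 2) := fun x ↦ by
    rw [stdGaussianPDFReal, mul_assoc, ← Real.exp_add]
    ring_nf
  have hbase : π / (1 / 2 - t) = (2 * π) / (1 - 2 * t) := by field_simp
  simp_rw [hexp]
  rw [integral_const_mul, GaussianFourier.integral_rexp_neg_mul_sq_norm hb, hbase,
    div_rpow (by positivity) h1.le, rpow_neg (by positivity), rpow_neg h1.le]
  field_simp

lemma lintegral_stdGaussianPDFReal :
    ∫⁻ x : E, ENNReal.ofReal (stdGaussianPDFReal x) = 1 := by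
  have h : ∫ x : E, stdGaussianPDFReal x = 1 := by
    simpa using integral_stdGaussianPDFReal_mul_exp (E := E) (t := 0) (by norm_num)
  have hi : Integrable (stdGaussianPDFReal : E → ℝ) :=
    .of_integral_ne_zero (by rw [h]; exact one_ne_zero)
  rw [← ofReal_integral_eq_lintegral_ofReal hi (ae_of_all _ stdGaussianPDFReal_nonneg), h,
    ENNReal.ofReal_one]

lemma integral_stdGaussianPDFReal_mul_cexp (t : E) :
    ∫ x : E, (stdGaussianPDFReal x : ℂ) * Complex.exp (⟪x, t⟫ * Complex.I) =
      Complex.exp (-‖t‖ ^ 2 / 2) := by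
  have hexp : ∀ x : E, (stdGaussianPDFReal x : ℂ) * Complex.exp (⟪x, t⟫ * Complex.I) =
      ((2 * π) ^ (-(Module.finrank ℝ E / 2 : ℝ)) : ℝ) *
        Complex.exp (-(1 / 2 : ℂ) * ‖x‖ ^ 2 + Complex.I * ⟪t, x⟫) := fun x ↦ by
    rw [stdGaussianPDFReal, Complex.ofReal_mul, mul_assoc, Complex.ofReal_exp, ← Complex.exp_add,
      real_inner_comm]
    congr 2
    push_cast
    ring
  have hconst : ((π : ℂ) / (1 / 2)) ^ (Module.finrank ℝ E / 2 : ℂ) =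
      (((2 * π) ^ (Module.finrank ℝ E / 2 : ℝ) : ℝ) : ℂ) := by
    rw [Complex.ofReal_cpow (by positivity)]
    push_cast
    congr 1
    ring
  simp_rw [hexp]
  rw [integral_const_mul, GaussianFourier.integral_cexp_neg_mul_sq_norm_add (by norm_num), hconst,
    ← mul_assoc, ← Complex.ofReal_mul, ← rpow_add (by positivity), neg_add_cancel, rpow_zero,
    Complex.ofReal_one, one_mul, Complex.I_sq]
  ring_nf

theorem stdGaussian_eq_withDensity :
    stdGaussian E = volume.withDensity fun x ↦ ENNReal.ofReal (stdGaussianPDFReal x) := by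
  have : IsFiniteMeasure
      ((volume : Measure E).withDensity fun x ↦ ENNReal.ofReal (stdGaussianPDFReal x)) :=
    isFiniteMeasure_withDensity (by simp [lintegral_stdGaussianPDFReal])
  refine Measure.ext_of_charFun (funext fun t ↦ ?_)
  rw [charFun_stdGaussian, charFun_apply,
    integral_withDensity_eq_integral_toReal_smul (by fun_prop) (by simp),
    ← integral_stdGaussianPDFReal_mul_cexp]
  simp only [ENNReal.toReal_ofReal (stdGaussianPDFReal_nonneg _), Complex.real_smul]

lemma exp_neg_mul_stdGaussian_real_le_image_add {S : Set E} (hS : MeasurableSet S) (v : E) {c : ℝ}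
    (hc : ∀ x ∈ S, ⟪v, x⟫ + ‖v‖ ^ 2 / 2 ≤ c) :
    rexp (-c) * (stdGaussian E).real S ≤ (stdGaussian E).real ((· + v) '' S) := by
  have hemb : MeasurableEmbedding (· + v : E → E) := measurableEmbedding_addRight v
  have hdensity : ∀ x ∈ S,
      rexp (-c) * stdGaussianPDFReal x ≤ stdGaussianPDFReal (x + v) := fun x hx ↦ by
    rw [stdGaussianPDFReal, stdGaussianPDFReal, mul_left_comm, ← Real.exp_add, norm_add_sq_real,
      real_inner_comm]
    gcongr
    linarith [hc x hx]
  have hle : ENNReal.ofReal (rexp (-c)) * stdGaussian E S ≤ stdGaussian E ((· + v) '' S) := by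
    rw [stdGaussian_eq_withDensity, withDensity_apply _ hS,
      withDensity_apply _ (hemb.measurableSet_image.2 hS),
      ← (measurePreserving_add_right volume v).setLIntegral_comp_emb hemb,
      ← lintegral_const_mul _ (by fun_prop)]
    refine setLIntegral_mono (by fun_prop) fun x hx ↦ ?_
    rw [← ENNReal.ofReal_mul (by positivity)]
    exact ENNReal.ofReal_le_ofReal (hdensity x hx)
  simpa only [ENNReal.toReal_mul, ENNReal.toReal_ofReal (Real.exp_nonneg _), measureReal_def] using
    ENNReal.toReal_mono (measure_ne_top _ _) hle

end Density

section Concentration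

variable {E : Type*} [NormedAddCommGroup E] [InnerProductSpace ℝ E] [FiniteDimensional ℝ E]
  [MeasurableSpace E] [BorelSpace E]

lemma mgf_norm_sq_stdGaussian {t : ℝ} (ht : t < 1 / 2) :
    mgf (fun x : E ↦ ‖x‖ ^ 2) (stdGaussian E) t =
      (1 - 2 * t) ^ (-(Module.finrank ℝ E / 2 : ℝ)) := by
  rw [mgf, stdGaussian_eq_withDensity,
    integral_withDensity_eq_integral_toReal_smul (by fun_prop) (by simp),
    ← integral_stdGaussianPDFReal_mul_exp ht]
  simp only [ENNReal.toReal_ofReal (stdGaussianPDFReal_nonneg _), smul_eq_mul]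

lemma one_sub_two_mul_rpow_neg_le {t d : ℝ} (ht : |t| ≤ 1 / 4) (hd : 0 ≤ d) :
    (1 - 2 * t) ^ (-(d / 2)) ≤ rexp (d * (t + 4 * t ^ 2)) := by
  have hpos : 1 / 2 ≤ 1 - 2 * t := by linarith [le_abs_self t]
  have hlog : -log (1 - 2 * t) ≤ 2 * t + 8 * t ^ 2 := by
    have hinv : (1 - 2 * t)⁻¹ ≤ 1 + 2 * t + 8 * t ^ 2 := by
      rw [inv_le_iff_one_le_mul₀ (by linarith)]
      nlinarith [mul_nonneg (sq_nonneg t) (sub_nonneg.2 hpos)]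
    linarith [one_sub_inv_le_log_of_pos (show 0 < 1 - 2 * t by linarith)]
  rw [rpow_def_of_pos (by linarith), Real.exp_le_exp]
  linarith [mul_le_mul_of_nonneg_left hlog hd]

lemma integrable_exp_mul_norm_sq_sub_stdGaussian {t : ℝ} (ht : t < 1 / 2) (c : ℝ) :
    Integrable (fun x : E ↦ rexp (t * (‖x‖ ^ 2 - c))) (stdGaussian E) := by
  have h : Integrable (fun x : E ↦ rexp (t * ‖x‖ ^ 2)) (stdGaussian E) := by
    refine .of_integral_ne_zero ?_
    rw [← mgf, mgf_norm_sq_stdGaussian ht]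
    exact (rpow_pos_of_pos (by linarith) _).ne'
  simpa only [mul_sub, Real.exp_sub] using h.div_const (rexp (t * c))

lemma mgf_norm_sq_sub_finrank_stdGaussian_le {t : ℝ} (ht : |t| ≤ 1 / 4) :
    mgf (fun x : E ↦ ‖x‖ ^ 2 - Module.finrank ℝ E) (stdGaussian E) t ≤
      rexp (4 * Module.finrank ℝ E * t ^ 2) := by
  simp only [sub_eq_add_neg, mgf_add_const]
  rw [mgf_norm_sq_stdGaussian (by linarith [le_abs_self t])]
  grw [one_sub_two_mul_rpow_neg_le ht (Nat.cast_nonneg _)]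
  rw [← Real.exp_add]
  exact (congrArg rexp (by ring)).le

lemma stdGaussian_real_le_abs_norm_sq_sub_le {ε : ℝ} (h0 : 0 ≤ ε) (h1 : ε ≤ 1) :
    (stdGaussian E).real {y | ε * Module.finrank ℝ E ≤ |‖y‖ ^ 2 - Module.finrank ℝ E|} ≤
      2 * rexp (-(Module.finrank ℝ E * ε ^ 2 / 16)) := by
  set d : ℝ := (Module.finrank ℝ E : ℝ)
  have habs : |ε / 8| ≤ 1 / 4 := by rw [abs_of_nonneg (by positivity)]; linarith
  have hupper : (stdGaussian E).real {y : E | ε * d ≤ ‖y‖ ^ 2 - d} ≤ rexp (-(d * ε ^ 2 / 16)) := by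
    grw [measure_ge_le_exp_mul_mgf (t := ε / 8) _ (by positivity)
      (integrable_exp_mul_norm_sq_sub_stdGaussian (by linarith) _),
      mgf_norm_sq_sub_finrank_stdGaussian_le habs, ← Real.exp_add]
    exact (congrArg rexp (by ring)).le
  have hlower : (stdGaussian E).real {y : E | ‖y‖ ^ 2 - d ≤ -(ε * d)} ≤
      rexp (-(d * ε ^ 2 / 16)) := by
    grw [measure_le_le_exp_mul_mgf (t := -(ε / 8)) _ (by linarith)
      (integrable_exp_mul_norm_sq_sub_stdGaussian (by linarith) _),
      mgf_norm_sq_sub_finrank_stdGaussian_le (by rwa [abs_neg]), ← Real.exp_add]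
    exact (congrArg rexp (by ring)).le
  have hsplit : {y : E | ε * d ≤ |‖y‖ ^ 2 - d|} =
      {y | ε * d ≤ ‖y‖ ^ 2 - d} ∪ {y | ‖y‖ ^ 2 - d ≤ -(ε * d)} := by
    ext y
    simp only [Set.mem_ofPred_eq, Set.mem_union, le_abs, le_neg]
  grw [hsplit, measureReal_union_le, hupper, hlower, two_mul]

lemma mul_le_abs_sq_sub_of_mul_sqrt_lt {r d ε : ℝ} (hr : 0 ≤ r) (hd : 0 ≤ d)
    (h : ε * √d < |r - √d|) : ε * d ≤ |r ^ 2 - d| := by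
  calc ε * d = ε * √d * √d := by rw [mul_assoc, mul_self_sqrt hd]
    _ ≤ |r - √d| * (r + √d) := by gcongr; linarith
    _ = |(r - √d) * (r + √d)| := by rw [abs_mul, abs_of_nonneg (show 0 ≤ r + √d by positivity)]
    _ = |r ^ 2 - d| := by rw [mul_comm, ← sq_sub_sq, sq_sqrt hd]

theorem stdGaussian_real_lt_abs_norm_sub_sqrt_le {ε : ℝ} (h0 : 0 ≤ ε) (h1 : ε ≤ 1) :
    (stdGaussian E).real {y | ε * √(Module.finrank ℝ E) < |‖y‖ - √(Module.finrank ℝ E)|} ≤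
      2 * rexp (-(Module.finrank ℝ E * ε ^ 2 / 16)) :=
  (measureReal_mono fun _ ↦
    mul_le_abs_sq_sub_of_mul_sqrt_lt (norm_nonneg _) (Nat.cast_nonneg _)).trans
    (stdGaussian_real_le_abs_norm_sq_sub_le h0 h1)

end Concentration

section Direction

variable {E : Type*} [NormedAddCommGroup E] [NormedSpace ℝ E] [MeasurableSpace E] [BorelSpace E]

lemma measurableSet_normalize_mem {K : Set E} (hK : MeasurableSet K) :
    MeasurableSet {y | NormedSpace.normalize y ∈ K} :=
  measurableSet_preimage (f := fun y : E ↦ ‖y‖⁻¹ • y) (by fun_prop) hK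

lemma setLIntegral_normalize_mem_fun_norm [FiniteDimensional ℝ E] [Nontrivial E] (μ : Measure E)
    [μ.IsAddHaarMeasure] {K : Set E} (hK : MeasurableSet K) {f : ℝ → ℝ≥0∞} (hf : Measurable f) :
    ∫⁻ y in {y | NormedSpace.normalize y ∈ K}, f ‖y‖ ∂μ =
      μ.toSphere {x | (x : E) ∈ K} *
        ∫⁻ r, f r ∂(Measure.volumeIoiPow (Module.finrank ℝ E - 1)) := by
  have hcap : MeasurableSet {x : Metric.sphere (0 : E) 1 | (x : E) ∈ K} := measurable_subtype_coe hK
  let F : Metric.sphere (0 : E) 1 × Set.Ioi (0 : ℝ) → ℝ≥0∞ := fun p ↦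
    {x : Metric.sphere (0 : E) 1 | (x : E) ∈ K}.indicator 1 p.1 * f p.2
  have hpolar : ∀ y : ({0}ᶜ : Set E),
      {y : E | NormedSpace.normalize y ∈ K}.indicator (fun y ↦ f ‖y‖) (y : E) =
        F (homeomorphUnitSphereProd E y) := fun y ↦ by
    classical simp [F, Set.indicator_apply, NormedSpace.normalize]
  calc ∫⁻ y in {y | NormedSpace.normalize y ∈ K}, f ‖y‖ ∂μ
      = ∫⁻ y in {0}ᶜ, {y | NormedSpace.normalize y ∈ K}.indicator (fun y ↦ f ‖y‖) y ∂μ := by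
        rw [restrict_compl_singleton, lintegral_indicator (measurableSet_normalize_mem hK)]
    _ = ∫⁻ y : ({0}ᶜ : Set E), F (homeomorphUnitSphereProd E y) ∂μ.comap Subtype.val := by
        rw [← lintegral_subtype_comap (measurableSet_singleton 0).compl, lintegral_congr hpolar]
    _ = ∫⁻ p, F p ∂μ.toSphere.prod (Measure.volumeIoiPow (Module.finrank ℝ E - 1)) :=
        μ.measurePreserving_homeomorphUnitSphereProd.lintegral_comp_emb
          (Homeomorph.measurableEmbedding _) F
    _ = _ := by
        rw [← lintegral_indicator_one hcap]
        exact lintegral_prod_mul (measurable_one.indicator hcap).aemeasurable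
          (hf.comp measurable_subtype_coe).aemeasurable

end Direction

section UniformSphere

variable {E : Type*} [NormedAddCommGroup E] [InnerProductSpace ℝ E] [FiniteDimensional ℝ E]
  [MeasurableSpace E] [BorelSpace E]

variable (E) in
/-- The uniform probability measure on the unit sphere of a Euclidean space `E`. It unfolds to
`sphereUniform n` when `E` is `EuclideanSpace ℝ (Fin n)`. -/
noncomputable def uniformSphere : Measure (Metric.sphere (0 : E) 1) :=
  ((volume : Measure E).toSphere Set.univ)⁻¹ • (volume : Measure E).toSphere

theorem uniformSphere_coe_mem [Nontrivial E] {K : Set E} (hK : MeasurableSet K) :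
    uniformSphere E {x | (x : E) ∈ K} = stdGaussian E {y | NormedSpace.normalize y ∈ K} := by
  let f : ℝ → ℝ≥0∞ := fun r ↦
    ENNReal.ofReal ((2 * π) ^ (-(Module.finrank ℝ E / 2 : ℝ)) * rexp (-r ^ 2 / 2))
  have hpolar : ∀ K : Set E, MeasurableSet K → stdGaussian E {y | NormedSpace.normalize y ∈ K} =
      (volume : Measure E).toSphere {x | (x : E) ∈ K} *
        ∫⁻ r, f r ∂(Measure.volumeIoiPow (Module.finrank ℝ E - 1)) := fun K hK ↦ by
    rw [stdGaussian_eq_withDensity, withDensity_apply _ (measurableSet_normalize_mem hK)]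
    exact setLIntegral_normalize_mem_fun_norm volume hK (f := f) (by fun_prop)
  have htotal := hpolar Set.univ .univ
  simp only [Set.mem_univ, Set.ofPred_true, measure_univ] at htotal
  rw [hpolar K hK, uniformSphere, Measure.smul_apply, smul_eq_mul, mul_comm,
    ENNReal.eq_inv_of_mul_eq_one_left ((mul_comm _ _).trans htotal.symm)]

end UniformSphere

section Slab

variable {E : Type*} [NormedAddCommGroup E] [InnerProductSpace ℝ E]

/-- The half-open slab of points whose inner product with `w` lies in `(a, b]`. -/
def slab (w : E) (a b : ℝ) : Set E := {x | ⟪w, x⟫ ∈ Set.Ioc a b}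

lemma slab_zero_add_mul_abs {t ε : ℝ} (hε : ε < 1) : slab (0 : E) t (t + ε * |t|) = ∅ := by
  refine Set.eq_empty_of_forall_notMem fun x hx ↦ ?_
  obtain ⟨hlt, hle⟩ : t < 0 ∧ 0 ≤ t + ε * |t| := by
    simpa only [slab, Set.mem_ofPred_eq, Set.mem_Ioc, inner_zero_left] using hx
  rw [abs_of_neg hlt] at hle
  nlinarith

lemma slab_eq_slab_normalize {w : E} (hw : w ≠ 0) (a b : ℝ) :
    slab w a b = slab (NormedSpace.normalize w) (‖w‖⁻¹ * a) (‖w‖⁻¹ * b) := by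
  have hw' : 0 < ‖w‖⁻¹ := inv_pos.2 (norm_pos_iff.2 hw)
  ext x
  simp only [slab, NormedSpace.normalize, Set.mem_ofPred_eq, Set.mem_Ioc, real_inner_smul_left,
    mul_lt_mul_iff_right₀ hw', mul_le_mul_iff_right₀ hw']

lemma image_add_smul_slab_subset {u : E} (hu : ‖u‖ = 1) (a δ : ℝ) (m : ℤ) :
    (· + (m : ℝ) • δ • u) '' slab u a (a + δ) ⊆ slab u (a + m • δ) (a + (m + 1) • δ) := by
  rintro _ ⟨x, ⟨hlt, hle⟩, rfl⟩
  simp only [slab, Set.mem_ofPred_eq, Set.mem_Ioc, inner_add_right, real_inner_smul_right,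
    real_inner_self_eq_norm_sq, hu, zsmul_eq_mul, Int.cast_add, Int.cast_one]
  constructor <;> linarith

lemma pairwise_disjoint_image_add_smul_slab {u : E} (hu : ‖u‖ = 1) (a δ : ℝ) :
    Pairwise (Function.onFun Disjoint
      fun m : ℕ ↦ (· + (m : ℝ) • δ • u) '' slab u a (a + δ)) := fun m l hml ↦
  ((Set.pairwise_disjoint_Ioc_add_zsmul a δ (Nat.cast_injective.ne hml)).preimage (⟪u, ·⟫)).mono
    (image_add_smul_slab_subset hu a δ m) (image_add_smul_slab_subset hu a δ l)

variable [FiniteDimensional ℝ E] [MeasurableSpace E] [BorelSpace E]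

lemma measurableSet_slab (w : E) (a b : ℝ) : MeasurableSet (slab w a b) :=
  measurableSet_preimage (f := (⟪w, ·⟫)) (by fun_prop) measurableSet_Ioc

lemma natCast_mul_stdGaussian_real_le_of_translates {S A : Set E} (hS : MeasurableSet S) (v : E)
    {N : ℕ} {c : ℝ} (hc : ∀ m < N, ∀ x ∈ S, ⟪(m : ℝ) • v, x⟫ + ‖(m : ℝ) • v‖ ^ 2 / 2 ≤ c)
    (hdisj : Pairwise (Function.onFun Disjoint fun m : ℕ ↦ (· + (m : ℝ) • v) '' S))
    (hsub : ∀ m : ℕ, (· + (m : ℝ) • v) '' S ⊆ A) :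
    N * (rexp (-c) * (stdGaussian E).real S) ≤ (stdGaussian E).real A := by
  have hmeas : ∀ m : ℕ, MeasurableSet ((· + (m : ℝ) • v) '' S) := fun m ↦
    (measurableEmbedding_addRight _).measurableSet_image.2 hS
  calc N * (rexp (-c) * (stdGaussian E).real S)
      = ∑ _m ∈ Finset.range N, rexp (-c) * (stdGaussian E).real S := by simp
    _ ≤ ∑ m ∈ Finset.range N, (stdGaussian E).real ((· + (m : ℝ) • v) '' S) :=
      Finset.sum_le_sum fun m hm ↦
        exp_neg_mul_stdGaussian_real_le_image_add hS _ (hc m (Finset.mem_range.1 hm))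
    _ = (stdGaussian E).real (⋃ m ∈ Finset.range N, (· + (m : ℝ) • v) '' S) :=
      (measureReal_biUnion_finset (fun m _ l _ h ↦ hdisj h) fun m _ ↦ hmeas m).symm
    _ ≤ (stdGaussian E).real A := measureReal_mono (Set.iUnion₂_subset fun m _ ↦ hsub m)

lemma natCast_mul_stdGaussian_real_inter_slab_le {A : Set E} (hA : MeasurableSet A) {u : E}
    (hu : ‖u‖ = 1) (hAu : ∀ x ∈ A, ∀ s : ℝ, 0 ≤ s → x + s • u ∈ A) {a δ : ℝ} (hδ : 0 ≤ δ) {N : ℕ}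
    (hN : N * (δ * (1 + |a|)) ≤ 1) :
    N * (rexp (-2) * (stdGaussian E).real (A ∩ slab u a (a + δ))) ≤ (stdGaussian E).real A := by
  refine natCast_mul_stdGaussian_real_le_of_translates (hA.inter (measurableSet_slab u _ _))
    (δ • u) (fun m hm x hx ↦ ?_) (fun m l hml ↦ ?_) (fun m ↦ ?_)
  · have hm' : (m : ℝ) + 1 ≤ N := by exact_mod_cast hm
    have hs : (m * δ + δ) * (1 + |a|) ≤ 1 :=
      (by nlinarith [mul_nonneg hδ (abs_nonneg a)] : _ ≤ N * (δ * (1 + |a|))).trans hN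
    have hx' : ⟪u, x⟫ ≤ |a| + δ := hx.2.2.trans (by gcongr; exact le_abs_self a)
    have hs0 : 0 ≤ m * δ := by positivity
    rw [smul_smul, real_inner_smul_left, norm_smul, hu, mul_one, norm_of_nonneg hs0]
    nlinarith [mul_le_mul_of_nonneg_left hx' hs0, mul_nonneg hs0 (abs_nonneg a),
      mul_nonneg hδ (abs_nonneg a)]
  · exact (pairwise_disjoint_image_add_smul_slab hu a δ hml).mono
      (Set.image_mono Set.inter_subset_right) (Set.image_mono Set.inter_subset_right)
  · rintro _ ⟨x, hx, rfl⟩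
    rw [smul_smul]
    exact hAu x hx.1 _ (by positivity)

/-- The translates of `A ∩ slab` by multiples of its width are disjoint and stay in `A`; about
`1 / (δ (1 + |a|))` of them have Gaussian mass comparable to that of `A ∩ slab`. -/
theorem stdGaussian_real_inter_slab_le {A : Set E} (hA : MeasurableSet A) {u : E} (hu : ‖u‖ = 1)
    (hAu : ∀ x ∈ A, ∀ s : ℝ, 0 ≤ s → x + s • u ∈ A) (a : ℝ) {δ : ℝ} (hδ : 0 ≤ δ) :
    (stdGaussian E).real (A ∩ slab u a (a + δ)) ≤
      18 * (δ * (1 + |a|)) * (stdGaussian E).real A := by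
  set μA := (stdGaussian E).real A
  set μS := (stdGaussian E).real (A ∩ slab u a (a + δ)) with hμS
  have hle : μS ≤ μA := measureReal_mono Set.inter_subset_left
  have hμS0 : 0 ≤ μS := measureReal_nonneg
  rcases hδ.eq_or_lt with rfl | hδ'
  · simp [hμS, slab]
  have hq : 0 < δ * (1 + |a|) := by positivity
  set q := δ * (1 + |a|)
  rcases le_total 1 q with hq1 | hq1
  · nlinarith
  set N := ⌊1 / q⌋₊
  have hNq : N * q ≤ 1 := (le_div_iff₀ hq).1 (Nat.floor_le (by positivity))
  have hN1 : (1 : ℝ) ≤ N := by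
    exact_mod_cast Nat.one_le_floor_iff _ |>.2 ((one_le_div hq).2 hq1)
  have hNq' : 1 ≤ 2 * (N * q) := by
    have := (div_lt_iff₀ hq).1 (Nat.lt_floor_add_one (1 / q))
    nlinarith
  have hexp : 1 / 9 ≤ rexp (-2) := by
    rw [show (-2 : ℝ) = -1 + -1 by norm_num, Real.exp_add]
    nlinarith [Real.exp_neg_one_gt_d9]
  calc μS ≤ 2 * (N * q) * (9 * rexp (-2)) * μS :=
        le_mul_of_one_le_left hμS0 (one_le_mul_of_one_le_of_one_le hNq' (by linarith))
    _ = 18 * q * (N * (rexp (-2) * μS)) := by ring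
    _ ≤ 18 * q * μA := by
      gcongr
      exact natCast_mul_stdGaussian_real_inter_slab_le hA hu hAu hδ hNq

lemma map_inner_stdGaussian {u : E} (hu : ‖u‖ = 1) :
    (stdGaussian E).map (⟪u, ·⟫) = gaussianReal 0 1 := by
  have h := IsGaussian.map_eq_gaussianReal (μ := stdGaussian E) (innerSL ℝ u)
  rw [integral_strongDual_stdGaussian, variance_dual_stdGaussian, innerSL_apply_norm, hu] at h
  simpa using h

lemma gaussianPDFReal_zero_one_le_exp (y : ℝ) : gaussianPDFReal 0 1 y ≤ rexp (-y ^ 2 / 2) := by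
  have hconst : (√(2 * π * (1 : NNReal)))⁻¹ ≤ 1 :=
    inv_le_one_of_one_le₀ (Real.one_le_sqrt.2 (by push_cast; linarith [Real.pi_gt_three]))
  simpa [gaussianPDFReal] using mul_le_mul_of_nonneg_right hconst (Real.exp_nonneg (-y ^ 2 / 2))

lemma abs_le_two_mul_abs_of_mem_Ioc {a y ε : ℝ} (hε : ε ≤ 1 / 2)
    (hy : y ∈ Set.Ioc a (a + ε * |a|)) : |a| ≤ 2 * |y| := by
  have hε' : ε * |a| ≤ 1 / 2 * |a| := by gcongr
  rcases abs_cases a with h | h <;> rcases abs_cases y with h' | h' <;> linarith [hy.1, hy.2]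

lemma gaussianReal_real_Ioc_add_mul_abs_le {a ε : ℝ} (hε : 0 ≤ ε) (hε' : ε ≤ 1 / 2) :
    (gaussianReal 0 1).real (Set.Ioc a (a + ε * |a|)) ≤ ε * |a| * rexp (-a ^ 2 / 8) := by
  have hpdf : ∀ y ∈ Set.Ioc a (a + ε * |a|), gaussianPDFReal 0 1 y ≤ rexp (-a ^ 2 / 8) :=
    fun y hy ↦ (gaussianPDFReal_zero_one_le_exp y).trans <| Real.exp_le_exp.2 <| by
      have := pow_le_pow_left₀ (abs_nonneg a) (abs_le_two_mul_abs_of_mem_Ioc hε' hy) 2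
      rw [mul_pow, sq_abs, sq_abs] at this
      linarith
  refine ENNReal.toReal_le_of_le_ofReal (by positivity) ?_
  rw [gaussianReal_apply _ one_ne_zero]
  calc ∫⁻ y in Set.Ioc a (a + ε * |a|), gaussianPDF 0 1 y
      ≤ ∫⁻ _ in Set.Ioc a (a + ε * |a|), ENNReal.ofReal (rexp (-a ^ 2 / 8)) :=
        setLIntegral_mono measurable_const fun y hy ↦ ENNReal.ofReal_le_ofReal (hpdf y hy)
    _ = ENNReal.ofReal (ε * |a| * rexp (-a ^ 2 / 8)) := by
        rw [setLIntegral_const, Real.volume_Ioc, add_sub_cancel_left, mul_comm,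
          ← ENNReal.ofReal_mul (by positivity)]

lemma stdGaussian_real_far_slab_le {u : E} (hu : ‖u‖ = 1) {a ε L : ℝ} (hε : 0 ≤ ε)
    (hε' : ε ≤ 1 / 2) (ha : 16 * L ≤ a ^ 2) :
    (stdGaussian E).real (slab u a (a + ε * |a|)) ≤ 4 * ε * rexp (-L) := by
  have hmap : (stdGaussian E).real (slab u a (a + ε * |a|)) =
      (gaussianReal 0 1).real (Set.Ioc a (a + ε * |a|)) := by
    rw [← map_inner_stdGaussian hu, map_measureReal_apply (by fun_prop) measurableSet_Ioc]
    rfl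
  have habs : |a| ≤ 4 * rexp (a ^ 2 / 16) := by
    linarith [Real.add_one_le_exp (a ^ 2 / 16), sq_nonneg (|a| - 2), sq_abs a]
  calc (stdGaussian E).real (slab u a (a + ε * |a|))
      ≤ ε * |a| * rexp (-a ^ 2 / 8) := hmap.trans_le (gaussianReal_real_Ioc_add_mul_abs_le hε hε')
    _ ≤ ε * (4 * rexp (a ^ 2 / 16)) * rexp (-a ^ 2 / 8) := by gcongr
    _ = 4 * ε * rexp (-(a ^ 2 / 16)) := by
        rw [show -(a ^ 2 / 16) = a ^ 2 / 16 + -a ^ 2 / 8 by ring, Real.exp_add]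
        ring
    _ ≤ 4 * ε * rexp (-L) := by gcongr; linarith

lemma stdGaussian_real_inter_unit_slab_le {A : Set E} (hA : MeasurableSet A) {u : E}
    (hu : ‖u‖ = 1) (hAu : ∀ x ∈ A, ∀ s : ℝ, 0 ≤ s → x + s • u ∈ A) (a : ℝ) {ε L : ℝ}
    (hε : 0 ≤ ε) (hε' : ε ≤ 1 / 2) (hL : 1 / 2 ≤ L) :
    (stdGaussian E).real (A ∩ slab u a (a + ε * |a|)) ≤
      450 * ε * L * (stdGaussian E).real A + 4 * ε * rexp (-L) := by
  rcases le_total (16 * L) (a ^ 2) with hfar | hnear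
  · calc _ ≤ (stdGaussian E).real (slab u a (a + ε * |a|)) :=
          measureReal_mono Set.inter_subset_right
      _ ≤ 4 * ε * rexp (-L) := stdGaussian_real_far_slab_le hu hε hε' hfar
      _ ≤ _ := le_add_of_nonneg_left (by positivity)
  · have hpoly : |a| * (1 + |a|) ≤ 25 * L := by nlinarith [sq_nonneg (|a| - 1), sq_abs a]
    calc _ ≤ 18 * (ε * |a| * (1 + |a|)) * (stdGaussian E).real A :=
          stdGaussian_real_inter_slab_le hA hu hAu a (by positivity)
      _ = 18 * (ε * (|a| * (1 + |a|))) * (stdGaussian E).real A := by ring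
      _ ≤ 18 * (ε * (25 * L)) * (stdGaussian E).real A := by gcongr
      _ = 450 * ε * L * (stdGaussian E).real A := by ring
      _ ≤ _ := le_add_of_nonneg_right (by positivity)

/-- Near slabs (`t² ≤ 16 L ‖w‖²`) are controlled by translation, far ones by the Gaussian tail. -/
theorem stdGaussian_real_inter_dilation_slab_le {A : Set E} (hA : MeasurableSet A) {w : E}
    (hAw : ∀ x ∈ A, ∀ s : ℝ, 0 ≤ s → x + s • w ∈ A) (t : ℝ) {ε L : ℝ} (hε : 0 ≤ ε)
    (hε' : ε ≤ 1 / 2) (hL : 1 / 2 ≤ L) :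
    (stdGaussian E).real (A ∩ slab w t (t + ε * |t|)) ≤
      450 * ε * L * (stdGaussian E).real A + 4 * ε * rexp (-L) := by
  rcases eq_or_ne w 0 with rfl | hw
  · rw [slab_zero_add_mul_abs (by linarith), Set.inter_empty, measureReal_empty]
    positivity
  have hthreshold : ‖w‖⁻¹ * (t + ε * |t|) = ‖w‖⁻¹ * t + ε * |‖w‖⁻¹ * t| := by
    rw [abs_mul, abs_inv, abs_norm]
    ring
  rw [slab_eq_slab_normalize hw, hthreshold]
  refine stdGaussian_real_inter_unit_slab_le hA (NormedSpace.norm_normalize_eq_one_iff.2 hw)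
    (fun x hx s hs ↦ ?_) _ hε hε' hL
  rw [NormedSpace.normalize, smul_smul]
  exact hAw x hx _ (by positivity)

end Slab

section MostViolatedCell

variable {E : Type*} [NormedAddCommGroup E] [InnerProductSpace ℝ E]

/-- The signed distance from `x` to the hyperplane `⟪w, x⟫ = t`, positive outside the halfspace
`⟪w, x⟫ ≤ t`; it has the junk value `0` when `w = 0`. -/
noncomputable def facetDist (w : E) (t : ℝ) (x : E) : ℝ := ‖w‖⁻¹ * (⟪w, x⟫ - t)

lemma facetDist_add_smul_le (w : E) (t : ℝ) (x v : E) {s : ℝ} (hs : 0 ≤ s) :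
    facetDist w t (x + s • v) ≤ facetDist w t x + s * ‖v‖ := by
  have hcs : ‖w‖⁻¹ * ⟪w, v⟫ ≤ ‖v‖ := by
    rcases eq_or_ne w 0 with rfl | hw
    · simp
    · exact (inv_mul_le_iff₀ (norm_pos_iff.2 hw)).2 (real_inner_le_norm w v)
  rw [facetDist, facetDist, inner_add_right, real_inner_smul_right]
  linarith [mul_le_mul_of_nonneg_left hcs hs]

lemma facetDist_add_smul_self (w : E) (t : ℝ) (x : E) (s : ℝ) :
    facetDist w t (x + s • w) = facetDist w t x + s * ‖w‖ := by
  rcases eq_or_ne w 0 with rfl | hw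
  · simp
  · rw [facetDist, facetDist, inner_add_right, real_inner_smul_right, real_inner_self_eq_norm_sq]
    field_simp
    ring

lemma facetDist_pos_of_lt {w x : E} {t : ℝ} (hw : w ≠ 0) (h : t < ⟪w, x⟫) :
    0 < facetDist w t x :=
  mul_pos (inv_pos.2 (norm_pos_iff.2 hw)) (sub_pos.2 h)

lemma lt_inner_of_facetDist_pos {w x : E} {t : ℝ} (h : 0 < facetDist w t x) : t < ⟪w, x⟫ :=
  sub_pos.1 (pos_of_mul_pos_right h (inv_nonneg.2 (norm_nonneg w)))

variable {ι : Type*} [LinearOrder ι]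

/-- The points at which the constraint `⟪w j, x⟫ ≤ t j` has the largest signed distance among all
constraints. Ties go to the largest index, so that distinct cells are disjoint. -/
def mostViolatedCell (w : ι → E) (t : ι → ℝ) (j : ι) : Set E :=
  {x | ∀ i, toLex (facetDist (w i) (t i) x, i) ≤ toLex (facetDist (w j) (t j) x, j)}

lemma pairwise_disjoint_mostViolatedCell (w : ι → E) (t : ι → ℝ) :
    Pairwise (Function.onFun Disjoint (mostViolatedCell w t)) := fun j l hjl ↦
  Set.disjoint_left.2 fun _ hj hl ↦
    hjl (congrArg (fun p ↦ (ofLex p).2) (le_antisymm (hl j) (hj l)))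

lemma exists_mem_mostViolatedCell [Finite ι] [Nonempty ι] (w : ι → E) (t : ι → ℝ) (x : E) :
    ∃ j, x ∈ mostViolatedCell w t j :=
  Finite.exists_max fun j ↦ toLex (facetDist (w j) (t j) x, j)

lemma facetDist_le_of_mem_mostViolatedCell {w : ι → E} {t : ι → ℝ} {j : ι} {x : E}
    (hx : x ∈ mostViolatedCell w t j) (i : ι) :
    facetDist (w i) (t i) x ≤ facetDist (w j) (t j) x :=
  Prod.Lex.monotone_fst _ _ (hx i)

lemma add_smul_mem_mostViolatedCell {w : ι → E} {t : ι → ℝ} {j : ι} {x : E}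
    (hx : x ∈ mostViolatedCell w t j) {s : ℝ} (hs : 0 ≤ s) :
    x + s • w j ∈ mostViolatedCell w t j := fun i ↦ by
  have hi := facetDist_add_smul_le (w i) (t i) x (w j) hs
  rw [facetDist_add_smul_self, Prod.Lex.toLex_le_toLex']
  refine ⟨by linarith [facetDist_le_of_mem_mostViolatedCell hx i], fun heq ↦ ?_⟩
  exact (Prod.Lex.toLex_le_toLex'.1 (hx i)).2
    ((facetDist_le_of_mem_mostViolatedCell hx i).antisymm (by linarith))

lemma measurableSet_mostViolatedCell [Countable ι] [MeasurableSpace E] [BorelSpace E]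
    [SecondCountableTopology E] (w : ι → E) (t : ι → ℝ) (j : ι) :
    MeasurableSet (mostViolatedCell w t j) := by
  have hdist : ∀ i, Measurable (facetDist (w i) (t i)) := fun i ↦ by
    unfold facetDist
    fun_prop
  simp only [mostViolatedCell, Prod.Lex.toLex_le_toLex, Set.ofPred_forall]
  exact .iInter fun i ↦ (measurableSet_lt (hdist i) (hdist j)).union
    ((measurableSet_eq_fun (hdist i) (hdist j)).inter (.const _))

end MostViolatedCell

section Polyhedron

variable {E : Type*} [NormedAddCommGroup E] [InnerProductSpace ℝ E] {ι : Type*}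

/-- The intersection of the halfspaces `⟪w j, x⟫ ≤ t j`, the coordinate-free form of
`polytope`. -/
def polyhedron (w : ι → E) (t : ι → ℝ) : Set E := {x | ∀ j, ⟪w j, x⟫ ≤ t j}

lemma polytope_eq_polyhedron {n k : ℕ} (W : Matrix (Fin n) (Fin k) ℝ) (θ : Fin k → ℝ) :
    polytope W θ = polyhedron (fun j ↦ WithLp.toLp 2 (W.transpose j)) θ := by
  ext x
  simp only [polytope, polyhedron, Set.mem_ofPred_eq, Pi.le_def, Matrix.mulVec, dotProduct,
    PiLp.inner_apply, RCLike.inner_apply, conj_trivial, mul_comm]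

lemma measurableSet_polyhedron [Countable ι] [MeasurableSpace E] [BorelSpace E]
    [SecondCountableTopology E] (w : ι → E) (t : ι → ℝ) : MeasurableSet (polyhedron w t) := by
  simp only [polyhedron, Set.ofPred_forall]
  exact .iInter fun j ↦ measurableSet_le (by fun_prop) measurable_const

lemma polyhedron_mono (w : ι → E) : Monotone (polyhedron w) :=
  fun _ _ h _ hx j ↦ (hx j).trans (h j)

lemma inv_smul_mem_polyhedron_iff {c : ℝ} (hc : 0 < c) {w : ι → E} {t : ι → ℝ} {x : E} :
    c⁻¹ • x ∈ polyhedron w t ↔ x ∈ polyhedron w (c • t) := by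
  simp only [polyhedron, Set.mem_ofPred_eq, real_inner_smul_right, inv_mul_le_iff₀ hc,
    Pi.smul_apply, smul_eq_mul]

lemma polyhedron_dilation_subset [LinearOrder ι] [Finite ι] (w : ι → E) (t : ι → ℝ) {ε : ℝ}
    (hε : ε < 1) :
    polyhedron w (t + ε • |t|) ⊆
      polyhedron w t ∪ ⋃ j, mostViolatedCell w t j ∩ slab (w j) (t j) (t j + ε * |t j|) := by
  intro x hx
  by_cases hxt : x ∈ polyhedron w t
  · exact .inl hxt
  obtain ⟨i, hi⟩ : ∃ i, t i < ⟪w i, x⟫ := by simpa [polyhedron] using hxt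
  have hwi : w i ≠ 0 := fun h0 ↦
    (slab_zero_add_mul_abs hε).le (show x ∈ slab 0 (t i) _ from h0 ▸ ⟨hi, hx i⟩)
  have : Nonempty ι := ⟨i⟩
  obtain ⟨j, hj⟩ := exists_mem_mostViolatedCell w t x
  have hpos : 0 < facetDist (w j) (t j) x :=
    (facetDist_pos_of_lt hwi hi).trans_le (facetDist_le_of_mem_mostViolatedCell hj i)
  exact .inr (Set.mem_iUnion.2 ⟨j, hj, lt_inner_of_facetDist_pos hpos, hx j⟩)

end Polyhedron

section Dilation

variable {E : Type*} [NormedAddCommGroup E] [InnerProductSpace ℝ E] [FiniteDimensional ℝ E]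
  [MeasurableSpace E] [BorelSpace E] {ι : Type*} [Fintype ι]

lemma half_le_log_natCast {m : ℕ} (hm : 2 ≤ m) : 1 / 2 ≤ log m := by
  have : log 2 ≤ log m := log_le_log two_pos (by exact_mod_cast hm)
  linarith [Real.log_two_gt_d9]

lemma sum_stdGaussian_real_mostViolatedCell_le_one [LinearOrder ι] (w : ι → E) (t : ι → ℝ) :
    ∑ j, (stdGaussian E).real (mostViolatedCell w t j) ≤ 1 := by
  rw [← measureReal_iUnion_fintype (pairwise_disjoint_mostViolatedCell w t)
    (measurableSet_mostViolatedCell w t)]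
  exact measureReal_le_one

theorem stdGaussian_real_polyhedron_dilation_le (hι : 2 ≤ Fintype.card ι) (w : ι → E) (t : ι → ℝ)
    {ε : ℝ} (hε : 0 ≤ ε) (hε' : ε ≤ 1 / 2) :
    (stdGaussian E).real (polyhedron w (t + ε • |t|)) ≤
      (stdGaussian E).real (polyhedron w t) + 500 * ε * log (Fintype.card ι) := by
  let _ : LinearOrder ι := .lift' (Fintype.equivFin ι) (Fintype.equivFin ι).injective
  set L := log (Fintype.card ι)
  have hL : 1 / 2 ≤ L := half_le_log_natCast hι
  have hcard : Fintype.card ι * rexp (-L) = 1 := by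
    have : (0 : ℝ) < Fintype.card ι := by exact_mod_cast two_pos.trans_le hι
    rw [Real.exp_neg, Real.exp_log this, mul_inv_cancel₀ this.ne']
  have hcells : ∑ j, (stdGaussian E).real
      (mostViolatedCell w t j ∩ slab (w j) (t j) (t j + ε * |t j|)) ≤ 500 * ε * L := by
    calc _ ≤ ∑ j, (450 * ε * L * (stdGaussian E).real (mostViolatedCell w t j) +
            4 * ε * rexp (-L)) :=
          Finset.sum_le_sum fun j _ ↦
            stdGaussian_real_inter_dilation_slab_le (measurableSet_mostViolatedCell w t j)
              (fun _ hx _ hs ↦ add_smul_mem_mostViolatedCell hx hs) (t j) hε hε' hL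
      _ = 450 * ε * L * ∑ j, (stdGaussian E).real (mostViolatedCell w t j) +
            4 * ε * (Fintype.card ι * rexp (-L)) := by
          rw [Finset.sum_add_distrib, ← Finset.mul_sum, Finset.sum_const, Finset.card_univ,
            nsmul_eq_mul]
          ring
      _ ≤ 450 * ε * L * 1 + 4 * ε * 1 := by
          gcongr
          exacts [sum_stdGaussian_real_mostViolatedCell_le_one w t, hcard.le]
      _ ≤ 500 * ε * L := by nlinarith
  calc _ ≤ (stdGaussian E).real (polyhedron w t ∪
          ⋃ j, mostViolatedCell w t j ∩ slab (w j) (t j) (t j + ε * |t j|)) :=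
        measureReal_mono (polyhedron_dilation_subset w t (by linarith)) (measure_ne_top _ _)
    _ ≤ _ := by grw [measureReal_union_le, measureReal_iUnion_fintype_le, hcells]

lemma le_sub_add_two_mul_mul_abs (t : ℝ) {ε : ℝ} (hε : 0 ≤ ε) (hε' : ε ≤ 1 / 2) :
    t ≤ t - ε * |t| + 2 * ε * abs (t - ε * |t|) := by
  have habs : |t| - ε * |t| ≤ abs (t - ε * |t|) := by
    simpa [abs_mul, abs_of_nonneg hε] using abs_sub_abs_le_abs_sub t (ε * |t|)
  nlinarith [mul_le_mul_of_nonneg_left habs hε, mul_nonneg hε (abs_nonneg t)]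

lemma abs_stdGaussian_real_sub_polyhedron_le (hι : 2 ≤ Fintype.card ι) (w : ι → E) (t : ι → ℝ)
    {ε : ℝ} (hε : 0 ≤ ε) (hε' : ε ≤ 1 / 4) {A B : Set E}
    (hinner : polyhedron w (t - ε • |t|) ⊆ A ∪ B) (houter : A ⊆ polyhedron w (t + ε • |t|) ∪ B) :
    |(stdGaussian E).real A - (stdGaussian E).real (polyhedron w t)| ≤
      1000 * ε * log (Fintype.card ι) + (stdGaussian E).real B := by
  have hsub : polyhedron w t ⊆ polyhedron w ((t - ε • |t|) + (2 * ε) • abs (t - ε • |t|)) :=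
    polyhedron_mono w fun j ↦ le_sub_add_two_mul_mul_abs (t j) hε (by linarith)
  have hshrunk := (measureReal_mono (μ := stdGaussian E) hsub).trans
    (stdGaussian_real_polyhedron_dilation_le hι w _ (by positivity) (by linarith))
  have hinner' := (measureReal_mono (μ := stdGaussian E) hinner).trans (measureReal_union_le A B)
  have houter' := (measureReal_mono (μ := stdGaussian E) houter).trans (measureReal_union_le _ B)
  have hdilation := stdGaussian_real_polyhedron_dilation_le (E := E) hι w t hε (by linarith)
  have hnonneg : 0 ≤ ε * log (Fintype.card ι) := mul_nonneg hε (log_natCast_nonneg _)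
  exact abs_sub_le_iff.2 ⟨by linarith, by linarith⟩

end Dilation

section Comparison

variable {E : Type*} [NormedAddCommGroup E] [InnerProductSpace ℝ E] {ι : Type*}

lemma mul_mem_Icc_of_abs_sub_le {r c ε : ℝ} (h : |r - c| ≤ ε * c) (hc : 0 ≤ c) (θ : ℝ) :
    r * θ ∈ Set.Icc (c * θ - ε * |c * θ|) (c * θ + ε * |c * θ|) := by
  have habs : |r * θ - c * θ| ≤ ε * |c * θ| := by
    rw [← sub_mul, abs_mul, abs_mul, abs_of_nonneg hc, ← mul_assoc]
    gcongr
  exact ⟨by linarith [(abs_le.1 habs).1], by linarith [(abs_le.1 habs).2]⟩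

lemma polyhedron_smul_mem_Icc {r c ε : ℝ} (h : |r - c| ≤ ε * c) (hc : 0 ≤ c) (w : ι → E)
    (θ : ι → ℝ) :
    polyhedron w (r • θ) ∈
      Set.Icc (polyhedron w (c • θ - ε • |c • θ|)) (polyhedron w (c • θ + ε • |c • θ|)) :=
  ⟨polyhedron_mono w fun j ↦ (mul_mem_Icc_of_abs_sub_le h hc (θ j)).1,
    polyhedron_mono w fun j ↦ (mul_mem_Icc_of_abs_sub_le h hc (θ j)).2⟩

lemma normalize_mem_polyhedron_iff {w : ι → E} {θ : ι → ℝ} {y : E} (hy : y ≠ 0) :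
    NormedSpace.normalize y ∈ polyhedron w θ ↔ y ∈ polyhedron w (‖y‖ • θ) :=
  inv_smul_mem_polyhedron_iff (norm_pos_iff.2 hy)

variable [FiniteDimensional ℝ E] [MeasurableSpace E] [BorelSpace E]

lemma uniformSphere_real_coe_mem_polyhedron [Nontrivial E] [Countable ι] (w : ι → E)
    (θ : ι → ℝ) :
    (uniformSphere E).real {x | (x : E) ∈ polyhedron w θ} =
      (stdGaussian E).real {y | NormedSpace.normalize y ∈ polyhedron w θ} :=
  congrArg ENNReal.toReal (uniformSphere_coe_mem (measurableSet_polyhedron w θ))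

theorem abs_uniformSphere_real_sub_stdGaussian_real_polyhedron_le [Nontrivial E] [Fintype ι]
    (hι : 2 ≤ Fintype.card ι) (w : ι → E) (θ : ι → ℝ) {ε : ℝ} (hε : 0 ≤ ε) :
    |(uniformSphere E).real {x | (x : E) ∈ polyhedron w θ} -
        (stdGaussian E).real {y | (√(Module.finrank ℝ E))⁻¹ • y ∈ polyhedron w θ}| ≤
      1000 * ε * log (Fintype.card ι) + 2 * rexp (-(Module.finrank ℝ E * ε ^ 2 / 16)) := by
  have hd : 0 < √(Module.finrank ℝ E : ℝ) :=
    Real.sqrt_pos.2 (Nat.cast_pos.2 Module.finrank_pos)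
  rw [uniformSphere_real_coe_mem_polyhedron]
  simp only [inv_smul_mem_polyhedron_iff hd, Set.ofPred_mem_eq]
  rcases le_total (1 / 4) ε with hlarge | hsmall
  · calc _ ≤ (1 : ℝ) := abs_sub_le_of_nonneg_of_le measureReal_nonneg measureReal_le_one
          measureReal_nonneg measureReal_le_one
      _ ≤ 1000 * (1 / 4) * (1 / 2) + 0 := by norm_num
      _ ≤ _ := by gcongr; exacts [half_le_log_natCast hι, by positivity]
  grw [← stdGaussian_real_lt_abs_norm_sub_sqrt_le (E := E) hε (hsmall.trans (by norm_num))]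
  have hne : ∀ y : E, |‖y‖ - √(Module.finrank ℝ E)| ≤ ε * √(Module.finrank ℝ E) → y ≠ 0 := by
    rintro _ hy rfl
    rw [norm_zero, zero_sub, abs_neg, abs_of_pos hd] at hy
    nlinarith
  refine abs_stdGaussian_real_sub_polyhedron_le hι w _ hε hsmall
    (fun y hy ↦ or_iff_not_imp_right.2 fun hfar ↦ ?_)
    fun y hy ↦ or_iff_not_imp_right.2 fun hfar ↦ ?_
  all_goals
    have hnear : |‖y‖ - √(Module.finrank ℝ E)| ≤ ε * √(Module.finrank ℝ E) := not_lt.1 hfar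
  · exact (normalize_mem_polyhedron_iff (hne y hnear)).2
      ((polyhedron_smul_mem_Icc hnear hd.le w θ).1 hy)
  · exact (polyhedron_smul_mem_Icc hnear hd.le w θ).2
      ((normalize_mem_polyhedron_iff (hne y hnear)).1 hy)

theorem lemma6p3_general [Fintype ι] (hd : 2 ≤ Module.finrank ℝ E) (hι : 2 ≤ Fintype.card ι)
    (w : ι → E) (θ : ι → ℝ) :
    |(uniformSphere E).real {x | (x : E) ∈ polyhedron w θ} -
        (stdGaussian E).real {y | (√(Module.finrank ℝ E))⁻¹ • y ∈ polyhedron w θ}| ≤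
      5000 * √(log (Module.finrank ℝ E)) * log (Fintype.card ι) / √(Module.finrank ℝ E) := by
  have : Nontrivial E := Module.nontrivial_of_finrank_pos (R := ℝ) (by lia)
  have hmain := abs_uniformSphere_real_sub_stdGaussian_real_polyhedron_le hι w θ
    (ε := 4 * √(log (Module.finrank ℝ E)) / √(Module.finrank ℝ E)) (by positivity)
  have hlogd : 1 / 2 ≤ log (Module.finrank ℝ E) := half_le_log_natCast hd
  have hlogι : 1 / 2 ≤ log (Fintype.card ι) := half_le_log_natCast hι
  set d : ℝ := (Module.finrank ℝ E : ℝ)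
  have hd1 : 1 ≤ d := Nat.one_le_cast.2 (one_le_two.trans hd)
  have hexp : rexp (-(d * (4 * √(log d) / √d) ^ 2 / 16)) ≤ 1 / √d := by
    have hexponent : d * (4 * √(log d) / √d) ^ 2 / 16 = log d := by
      rw [div_pow, mul_pow, sq_sqrt (by linarith), sq_sqrt (by linarith)]
      field_simp
      norm_num
    rw [hexponent, Real.exp_neg, Real.exp_log (by linarith), one_div]
    gcongr
    exact Real.sqrt_le_left (by linarith) |>.2 (by nlinarith)
  have hsqrt : 1 / 2 ≤ √(log d) := Real.le_sqrt_of_sq_le (by linarith)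
  have hprod : 1 / 2 * (1 / 2) ≤ √(log d) * log (Fintype.card ι) := by gcongr
  calc _ ≤ 1000 * (4 * √(log d) / √d) * log (Fintype.card ι) + 2 * (1 / √d) := by
        grw [← hexp]
        exact hmain
    _ = (4000 * (√(log d) * log (Fintype.card ι)) + 2) / √d := by ring
    _ ≤ 5000 * √(log d) * log (Fintype.card ι) / √d := by gcongr; linarith

end Comparison

lemma sqrt_log_natCast_le_two_mul {m : ℕ} (hm : 2 ≤ m) : √(log m) ≤ 2 * log m :=
  Real.sqrt_le_iff.2 ⟨by positivity, by nlinarith [half_le_log_natCast hm]⟩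

theorem lemma6p3 :
    ∃ C : ℝ, 0 < C ∧ ∀ (n k : ℕ), 2 ≤ n → 2 ≤ k →
      ∀ (W : Matrix (Fin n) (Fin k) ℝ) (θ : Fin k → ℝ),
        |(sphereUniform n).real {x | (x : EuclideanSpace ℝ (Fin n)) ∈ polytope W θ} -
            (ProbabilityTheory.stdGaussian (EuclideanSpace ℝ (Fin n))).real
              {y | (Real.sqrt n)⁻¹ • y ∈ polytope W θ}| ≤
          C * Real.log n * Real.log k / Real.sqrt n := by
  refine ⟨10000, by norm_num, fun n k hn hk W θ ↦ ?_⟩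
  have hgeneral := lemma6p3_general (E := EuclideanSpace ℝ (Fin n)) (by simpa using hn)
    (by simpa using hk) (fun j ↦ WithLp.toLp 2 (W.transpose j)) θ
  rw [finrank_euclideanSpace_fin, Fintype.card_fin, ← polytope_eq_polyhedron] at hgeneral
  calc _ ≤ 5000 * √(log n) * log k / √n := hgeneral
    _ ≤ 5000 * (2 * log n) * log k / √n := by gcongr; exact sqrt_log_natCast_le_two_mul hn
    _ = 10000 * log n * log k / √n := by ring
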